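/- **Setting.** Let $F$ be a totally real number field, $L/F$ a quadratic extension with a fixed embedding $L\subset\mathbb R$ (so $F\subset L\subset\mathbb R$), and $\tau$ the non-trivial automorphism of $L$ over $F$. Let $n\ge 1$ and let $\vec\alpha=(\alpha_1,\dots,\alpha_n)$ with $\alpha_i\in\mathcal O_F$, $\alpha_i>0$, and $\sigma(\alpha_i)<0$ for every embedding $\sigma:F\to\mathbb R$ other than the fixed one. Put $J^{\vec\alpha}=\operatorname{diag}(\alpha_1,\dots,\alpha_n,-1)$, $\vec\alpha_1=(\alpha_2,\dots,\alpha_n)$, $$\operatorname{SO}(J^{\vec\alpha},\mathcal O_F)=\{A\in \operatorname{SL}(n+1,\mathcal O_F)\mid A^{t}J^{\vec\alpha}A=J^{\vec\alpha}\},\qquad \operatorname{SU}(J^{\vec\alpha},\mathcal O_L,\tau)=\{A\in \operatorname{SL}(n+1,\mathcal O_L)\mid \tau(A)^{t}J^{\vec\alpha}A=J^{\vec\alpha}\},$$ regarded as subgroups of $\operatorname{SL}(n+1,\mathbb R)$. Let $\mathbb H^n=\{x\in\mathbb R^{n+1}\mid x^tJ^{\vec\alpha}x=-1,\ x_{n+1}>0\}$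 and $\mathbb H^{n-1}=\mathbb H^n\cap\{x_1=0\}$. Let $\Gamma$ be a torsion-free finite-index subgroup of $\operatorname{SO}(J^{\vec\alpha},\mathcal O_F)$ preserving $\mathbb H^n$, and $\Gamma_1$ a finite-index subgroup of $\operatorname{SO}(J^{\vec\alpha_1},\mathcal O_F)$ which, embedded as $A\mapsto\operatorname{diag}(1,A)$, lies in $\Gamma$ and is such that $M_1=\mathbb H^{n-1}/\Gamma_1\to M=\mathbb H^n/\Gamma$ is injective (an embedded totally geodesic hypersurface). For $t\in\mathbb R$ let $B_t=\operatorname{diag}(e^{-nt},e^t,\dots,e^t)\in\operatorname{SL}(n+1,\mathbb R)$. Let $C_1,C_2$ be (in either order) the two connected components of $\mathbb H^n\setminus\bigcup_{\gamma\in\Gamma}\gamma\mathbb H^{n-1}$ whose closures contain $\mathbb H^{n-1}$. A homomorphism $\rho_t:\Gamma\to\operatorname{SL}(n+1,\mathbb R)$ is *obtained by bending $M$ along $M_1$* if $\rho_t(\gamma)=\gamma$ for $\gamma\in\operatorname{Stab}_\Gamma(C_1)$ and moreover * if $M\setminus M_1$ is disconnected, $\rho_t(\gamma)=B_t\gamma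 B_t^{-1}$ for $\gamma\in \operatorname{Stab}_\Gamma(C_2)$; * if $M\setminus M_1$ is connected, $\rho_t(s)=B_ts$ for some $s\in\Gamma$ with $sC_1=C_2$. (Here $\operatorname{Stab}_\Gamma(C_i)$ is the fundamental group of the component of $M\setminus M_1$ covered by $C_i$; $\Gamma$ is the amalgamated product of the two stabilizers over $\Gamma_1$ in the first case, and the HNN extension of $\operatorname{Stab}_\Gamma(C_1)$ with stable letter $s$ in the second.) **Theorem.** Let $u\in\mathcal O_L$ be $\tau$-unitary, i.e. $\tau(u)u=1$, and let $t=\log|u|$. Then 1. $B_t\in\operatorname{SU}(J^{\vec\alpha},\mathcal O_L,\tau)$; 2. $B_t$ centralizes $\Gamma_1$ (embedded as $\operatorname{diag}(1,\Gamma_1)$); 3. if $\rho_t$ is obtained by bending $M$ along $M_1$, then $\rho_t(\Gamma)\subset\operatorname{SU}(J^{\vec\alpha},\mathcal O_L,\tau)$. -/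

import Mathlib

open Matrix

noncomputable section

namespace Bending

/-- Write `SLn n R` for the special linear group of `n × n` matrices over `R`. -/
abbrev SLn (n : ℕ) (R : Type*) [CommRing R] : Type _ := Matrix.SpecialLinearGroup (Fin n) R

/-- The diagonal form `J^α = diag(α₁, …, αₙ, -1)`. -/
def formMatrix {R : Type*} [CommRing R] {n : ℕ} (α : Fin n → R) :
    Matrix (Fin (n + 1)) (Fin (n + 1)) R :=
  Matrix.diagonal (Fin.snoc (α := fun _ => R) α (-1))

/-- `SU(J^α, R, τ) = {A ∈ SL(n+1, R) | A* J^α A = J^α}`, where `τ` is an automorphism of `R` and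
`A*` is the transpose of `A` with `τ` applied to its entries. -/
def specialUnitary {R : Type*} [CommRing R] {n : ℕ} (α : Fin n → R) (τ : R ≃+* R) :
    Subgroup (SLn (n + 1) R) where
  carrier := {A | ((A : Matrix (Fin (n + 1)) (Fin (n + 1)) R)ᵀ.map τ) * formMatrix α *
    (A : Matrix (Fin (n + 1)) (Fin (n + 1)) R) = formMatrix α}
  one_mem' := by
    simp [Matrix.map_one]
  mul_mem' := by
    intro A B hA hB
    simp only [Set.mem_ofPred_eq] at hA hB ⊢
    have h : ((A * B : SLn (n + 1) R) : Matrix (Fin (n + 1)) (Fin (n + 1)) R)ᵀ.map τ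
        = (B : Matrix (Fin (n + 1)) (Fin (n + 1)) R)ᵀ.map τ *
          (A : Matrix (Fin (n + 1)) (Fin (n + 1)) R)ᵀ.map τ := by
      rw [Matrix.SpecialLinearGroup.coe_mul, Matrix.transpose_mul, Matrix.map_mul]
    rw [h, Matrix.SpecialLinearGroup.coe_mul]
    calc _ = (B : Matrix (Fin (n + 1)) (Fin (n + 1)) R)ᵀ.map τ *
          ((A : Matrix (Fin (n + 1)) (Fin (n + 1)) R)ᵀ.map τ * formMatrix α *
            (A : Matrix (Fin (n + 1)) (Fin (n + 1)) R)) *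
          (B : Matrix (Fin (n + 1)) (Fin (n + 1)) R) := by simp only [Matrix.mul_assoc]
      _ = _ := by rw [hA, hB]
  inv_mem' := by
    intro A hA
    simp only [Set.mem_ofPred_eq] at hA ⊢
    have h1 : (A : Matrix (Fin (n + 1)) (Fin (n + 1)) R) *
        ((A⁻¹ : SLn (n + 1) R) : Matrix (Fin (n + 1)) (Fin (n + 1)) R) = 1 := by
      rw [← Matrix.SpecialLinearGroup.coe_mul, mul_inv_cancel, Matrix.SpecialLinearGroup.coe_one]
    have h2 : ((A⁻¹ : SLn (n + 1) R) : Matrix (Fin (n + 1)) (Fin (n + 1)) R)ᵀ.map τ *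
        (A : Matrix (Fin (n + 1)) (Fin (n + 1)) R)ᵀ.map τ = 1 := by
      rw [← Matrix.map_mul, ← Matrix.transpose_mul, h1]
      simp [Matrix.map_one]
    calc _ = ((A⁻¹ : SLn (n + 1) R) : Matrix (Fin (n + 1)) (Fin (n + 1)) R)ᵀ.map τ *
          ((A : Matrix (Fin (n + 1)) (Fin (n + 1)) R)ᵀ.map τ * formMatrix α *
            (A : Matrix (Fin (n + 1)) (Fin (n + 1)) R)) *
          ((A⁻¹ : SLn (n + 1) R) : Matrix (Fin (n + 1)) (Fin (n + 1)) R) := by rw [hA]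
      _ = (((A⁻¹ : SLn (n + 1) R) : Matrix (Fin (n + 1)) (Fin (n + 1)) R)ᵀ.map τ *
          (A : Matrix (Fin (n + 1)) (Fin (n + 1)) R)ᵀ.map τ) * formMatrix α *
            ((A : Matrix (Fin (n + 1)) (Fin (n + 1)) R) *
          ((A⁻¹ : SLn (n + 1) R) : Matrix (Fin (n + 1)) (Fin (n + 1)) R)) := by
            simp only [Matrix.mul_assoc]
      _ = _ := by rw [h1, h2, one_mul, mul_one]

/-- `SO(J^α, R) = {A ∈ SL(n+1, R) | Aᵗ J^α A = J^α}` (the previous group for the trivial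
automorphism). -/
def specialOrthogonal {R : Type*} [CommRing R] {n : ℕ} (α : Fin n → R) :
    Subgroup (SLn (n + 1) R) :=
  (specialUnitary α (RingEquiv.refl R)).copy
    {A | (A : Matrix (Fin (n + 1)) (Fin (n + 1)) R)ᵀ * formMatrix α *
      (A : Matrix (Fin (n + 1)) (Fin (n + 1)) R) = formMatrix α}
    (by
      have h (A : SLn (n + 1) R) : (A : Matrix (Fin (n + 1)) (Fin (n + 1)) R)ᵀ.map
          (RingEquiv.refl R) = (A : Matrix (Fin (n + 1)) (Fin (n + 1)) R)ᵀ := by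
        ext i j; simp
      ext A
      change _ ↔ (A : Matrix (Fin (n + 1)) (Fin (n + 1)) R)ᵀ.map (RingEquiv.refl R) *
        formMatrix α * (A : Matrix (Fin (n + 1)) (Fin (n + 1)) R) = formMatrix α
      rw [h A]; rfl)

/-- The map `SL(n, 𝓞 K) → SL(n, ℝ)` induced by a real embedding of the number field `K`. -/
def toReal {K : Type*} [Field K] (n : ℕ) (ι : K →+* ℝ) :
    SLn n (NumberField.RingOfIntegers K) →* SLn n ℝ :=
  Matrix.SpecialLinearGroup.map (ι.comp (algebraMap (NumberField.RingOfIntegers K) K))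

/-- The block embedding `A ↦ diag(1, A)` on matrices. -/
def blockMatrix {n : ℕ} (A : Matrix (Fin n) (Fin n) ℝ) : Matrix (Fin (n + 1)) (Fin (n + 1)) ℝ :=
  Matrix.of (Fin.cons (Fin.cons 1 0) (fun i => Fin.cons 0 (A i)))

theorem blockMatrix_det {n : ℕ} (A : Matrix (Fin n) (Fin n) ℝ) :
    (blockMatrix A).det = A.det := by
  rw [Matrix.det_succ_row_zero, Fin.sum_univ_succ]
  have h : (blockMatrix A).submatrix Fin.succ (Fin.succAbove 0) = A := by
    ext i j; simp [blockMatrix]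
  rw [h]
  simp [blockMatrix]

/-- The block embedding `SL(n, ℝ) → SL(n+1, ℝ)`, `A ↦ diag(1, A)`. -/
def block {n : ℕ} (A : SLn n ℝ) : SLn (n + 1) ℝ :=
  ⟨blockMatrix (A : Matrix (Fin n) (Fin n) ℝ), by rw [blockMatrix_det]; exact A.2⟩

/-- The bending matrix `B_t = diag(e^{-nt}, e^t, …, e^t) ∈ SL(n+1, ℝ)`. -/
def bendingMatrix (n : ℕ) (t : ℝ) : SLn (n + 1) ℝ :=
  ⟨Matrix.diagonal (Fin.cons (Real.exp (-(n * t))) (fun _ => Real.exp t)), by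
    rw [Matrix.det_diagonal, Fin.prod_univ_succ]
    simp only [Fin.cons_zero, Fin.cons_succ, Finset.prod_const, Finset.card_univ,
      Fintype.card_fin]
    rw [← Real.exp_nat_mul, ← Real.exp_add]
    simp⟩

/-- Hyperbolic `n`-space of the form `a₁x₁² + … + aₙxₙ² - xₙ₊₁²`, in the hyperboloid model:
the sheet `xₙ₊₁ > 0` of the level set `-1` in `ℝⁿ⁺¹`. -/
def hyperbolicSpace {n : ℕ} (a : Fin n → ℝ) : Set (Fin (n + 1) → ℝ) :=
  {x | x ⬝ᵥ (formMatrix a *ᵥ x) = -1 ∧ 0 < x (Fin.last n)}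

/-- The copy of hyperbolic `(n-1)`-space cut out of `hyperbolicSpace a` by `x₁ = 0`. -/
def wall {n : ℕ} (a : Fin n → ℝ) : Set (Fin (n + 1) → ℝ) :=
  {x | x ∈ hyperbolicSpace a ∧ x 0 = 0}

/-- `γ ∈ SL(n, ℝ)` acting on a subset of `ℝⁿ`. -/
def translate {n : ℕ} (γ : SLn n ℝ) (S : Set (Fin n → ℝ)) : Set (Fin n → ℝ) :=
  (fun x => (γ : Matrix (Fin n) (Fin n) ℝ) *ᵥ x) '' S

/-- `Γ` is a torsion-free group that maps the sheet `hyperbolicSpace a` to itself.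
For a discrete group `Γ` of isometries of the form, `M = ℍⁿ/Γ` is then a complete
hyperbolic manifold with fundamental group `Γ`. -/
structure IsManifoldGroup {n : ℕ} (a : Fin n → ℝ) (Γ : Subgroup (SLn (n + 1) ℝ)) : Prop where
  translate_eq : ∀ γ ∈ Γ, translate γ (hyperbolicSpace a) = hyperbolicSpace a
  torsionFree : ∀ γ ∈ Γ, IsOfFinOrder γ → γ = 1

/-- `Γ₁`, embedded as `diag(1, Γ₁)`, is a subgroup of `Γ` and the induced map
`M₁ = ℍⁿ⁻¹/Γ₁ → M = ℍⁿ/Γ` is injective: points of the wall that are equivalent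
under `Γ` are equivalent under `Γ₁`. -/
structure IsEmbeddedHypersurface {n : ℕ} (a : Fin n → ℝ)
    (Γ : Subgroup (SLn (n + 1) ℝ)) (Γ₁ : Subgroup (SLn n ℝ)) : Prop where
  block_mem : ∀ δ ∈ Γ₁, block δ ∈ Γ
  injective : ∀ x ∈ wall a, ∀ y ∈ wall a, ∀ γ ∈ Γ,
    (γ : Matrix (Fin (n + 1)) (Fin (n + 1)) ℝ) *ᵥ x = y →
      ∃ δ ∈ Γ₁, (block δ : Matrix (Fin (n + 1)) (Fin (n + 1)) ℝ) *ᵥ x = y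

/-- The preimage in `ℍⁿ` of `M ∖ M₁`: the complement of all `Γ`-translates of the wall. -/
def cutSpace {n : ℕ} (a : Fin n → ℝ) (Γ : Subgroup (SLn (n + 1) ℝ)) : Set (Fin (n + 1) → ℝ) :=
  hyperbolicSpace a \ ⋃ γ ∈ Γ, translate γ (wall a)

/-- `C` is a connected component of the preimage of `M ∖ M₁`. These components are convex, so
each of them is the universal cover of the component of `M ∖ M₁` below it. -/
def IsChamber {n : ℕ} (a : Fin n → ℝ) (Γ : Subgroup (SLn (n + 1) ℝ))
    (C : Set (Fin (n + 1) → ℝ)) : Prop :=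
  ∃ x ∈ cutSpace a Γ, C = connectedComponentIn (cutSpace a Γ) x

/-- `M ∖ M₁` is disconnected: `Γ` does not permute the components of its preimage transitively. -/
def IsSeparating {n : ℕ} (a : Fin n → ℝ) (Γ : Subgroup (SLn (n + 1) ℝ)) : Prop :=
  ¬ ∀ C C', IsChamber a Γ C → IsChamber a Γ C' → ∃ γ ∈ Γ, translate γ C = C'

/-- `C₁` and `C₂` are the two components on the two sides of the wall (in either order). -/
structure AreSides {n : ℕ} (a : Fin n → ℝ) (Γ : Subgroup (SLn (n + 1) ℝ))
    (C₁ C₂ : Set (Fin (n + 1) → ℝ)) : Prop where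
  chamber₁ : IsChamber a Γ C₁
  chamber₂ : IsChamber a Γ C₂
  ne : C₁ ≠ C₂
  wall_subset₁ : wall a ⊆ closure C₁
  wall_subset₂ : wall a ⊆ closure C₂

/-- The homomorphism `ρ : Γ → SL(n+1, ℝ)` is obtained by bending `M = ℍⁿ/Γ` along `M₁` with
parameter `t`. The stabilizer in `Γ` of a component `C` of the preimage of `M ∖ M₁` is the
fundamental group of the component of `M ∖ M₁` covered by `C`.

* If `M₁` separates `M`, then `Γ` is the amalgamated product of the stabilizers of the two
  components `C₁`, `C₂` adjacent to the wall; `ρ` is the inclusion on the first factor and the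
  inclusion conjugated by `B_t` on the second.
* Otherwise `Γ` is the HNN extension of the stabilizer of `C₁` with a stable letter `s` that
  carries `C₁` to the component `C₂` on the other side of the wall; `ρ` is the inclusion on the
  stabilizer, and `ρ s = B_t s`. -/
def IsBending {n : ℕ} (a : Fin n → ℝ) (Γ : Subgroup (SLn (n + 1) ℝ)) (t : ℝ)
    (ρ : Γ →* SLn (n + 1) ℝ) : Prop :=
  ∃ C₁ C₂, AreSides a Γ C₁ C₂ ∧
    (∀ γ : Γ, translate (γ : SLn (n + 1) ℝ) C₁ = C₁ → ρ γ = γ) ∧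
    (IsSeparating a Γ → ∀ γ : Γ, translate (γ : SLn (n + 1) ℝ) C₂ = C₂ →
      ρ γ = bendingMatrix n t * γ * (bendingMatrix n t)⁻¹) ∧
    (¬ IsSeparating a Γ → ∃ s : Γ, translate (s : SLn (n + 1) ℝ) C₁ = C₂ ∧
      ρ s = bendingMatrix n t * s)

end Bending

end

/-! The preimage under `ρ` of the unitary group is a subgroup of `Γ`, so it suffices that it
contains generators. Since `τ` fixes `F`, integral orthogonal matrices over `F` are unitary over
`L`; and up to the sign of `u`, `B_t` is the diagonal matrix with entries `τ(u)^n, u, …, u`, each of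
them `τ`-unitary. Hence `γ`, `B_t γ B_t⁻¹` and `B_t s` are all unitary.

What remains is that `Γ` is generated by the two side stabilizers, or by one of them and `s`. This
is read off from the connectedness of hyperbolic space (`AreSides.chamber_induction`): a property of
chambers that survives every wall crossing is shared by all chambers. Two facts make crossings well
behaved. The walls are locally finite (`exists_nhds_disjoint_translate_wall`), because their normals
are integral vectors of fixed norm for a form definite at every real place but one
(`finite_setOf_form_eq`). And a translate of the wall that meets the wall lies in it
(`translate_wall_subset`), because `M₁` is embedded and `Γ` is torsion-free. So only two chambers
are visible near a wall point. -/

open Topology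

namespace Bending


/-! ### The Lorentzian form and the hyperboloid -/

/-- The bilinear form of `formMatrix a`. -/
def form {R : Type*} [CommRing R] {n : ℕ} (a : Fin n → R) (x y : Fin (n + 1) → R) : R :=
  x ⬝ᵥ (formMatrix a *ᵥ y)

theorem form_apply {R : Type*} [CommRing R] {n : ℕ} (a : Fin n → R) (x y : Fin (n + 1) → R) :
    form a x y = ∑ i : Fin n, a i * x i.castSucc * y i.castSucc
      - x (Fin.last n) * y (Fin.last n) := by
  simp only [form, formMatrix, dotProduct, mulVec_diagonal, Fin.sum_univ_castSucc,
    Fin.snoc_castSucc, Fin.snoc_last]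
  rw [sub_eq_add_neg]
  congr 1
  · exact Finset.sum_congr rfl fun i _ => by ring
  · ring

theorem form_mulVec {R : Type*} [CommRing R] {n : ℕ} {a : Fin n → R}
    {A : Matrix (Fin (n + 1)) (Fin (n + 1)) R} (hA : Aᵀ * formMatrix a * A = formMatrix a)
    (x y : Fin (n + 1) → R) : form a (A *ᵥ x) (A *ᵥ y) = form a x y := by
  conv_rhs => rw [form, ← hA]
  simp only [form, ← Matrix.mulVec_mulVec, Matrix.dotProduct_mulVec, Matrix.vecMul_transpose]

theorem continuous_form_left {n : ℕ} (a : Fin n → ℝ) (y : Fin (n + 1) → ℝ) :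
    Continuous fun x => form a x y := by
  simp only [form_apply]
  fun_prop

theorem mem_hyperbolicSpace_iff {n : ℕ} {a : Fin n → ℝ} {x : Fin (n + 1) → ℝ} :
    x ∈ hyperbolicSpace a ↔
      x (Fin.last n) ^ 2 = 1 + ∑ i : Fin n, a i * x i.castSucc ^ 2 ∧ 0 < x (Fin.last n) := by
  change form a x x = -1 ∧ _ ↔ _
  have h : ∑ i : Fin n, a i * x i.castSucc * x i.castSucc = ∑ i : Fin n, a i * x i.castSucc ^ 2 :=
    Finset.sum_congr rfl fun i _ => by ring
  rw [form_apply, h]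
  refine and_congr_left fun _ => ⟨fun h => ?_, fun h => ?_⟩ <;> linarith

/-- Reversing the sign of the form along the timelike vector `x` yields the positive definite form
`form v v + 2 (form x v)²`, which therefore dominates the last coordinate. The factor depends only
on the height of `x`. -/
theorem sq_last_le_of_form {n : ℕ} {a : Fin n → ℝ} (ha : ∀ i, 0 < a i) {x v : Fin (n + 1) → ℝ}
    (hx : x ∈ hyperbolicSpace a) :
    v (Fin.last n) ^ 2 ≤ (2 * x (Fin.last n) ^ 2 - 1) * (2 * form a x v ^ 2 + form a v v) := by
  rw [mem_hyperbolicSpace_iff] at hx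
  have hCS : (∑ i : Fin n, a i * x i.castSucc * v i.castSucc) ^ 2 ≤
      (∑ i : Fin n, a i * x i.castSucc ^ 2) * ∑ i : Fin n, a i * v i.castSucc ^ 2 :=
    Finset.sum_sq_le_sum_mul_sum_of_sq_le_mul _
      (fun i _ => mul_nonneg (ha i).le (sq_nonneg _))
      (fun i _ => mul_nonneg (ha i).le (sq_nonneg _)) (fun i _ => le_of_eq (by ring))
  have hv : form a v v = ∑ i : Fin n, a i * v i.castSucc ^ 2 - v (Fin.last n) ^ 2 := by
    rw [form_apply, pow_two (v (Fin.last n))]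
    congr 1
    exact Finset.sum_congr rfl fun i _ => by ring
  have hr : 0 ≤ ∑ i : Fin n, a i * x i.castSucc ^ 2 :=
    Finset.sum_nonneg fun i _ => mul_nonneg (ha i).le (sq_nonneg _)
  have hw : 0 ≤ ∑ i : Fin n, a i * v i.castSucc ^ 2 :=
    Finset.sum_nonneg fun i _ => mul_nonneg (ha i).le (sq_nonneg _)
  have hP := form_apply a x v
  generalize form a x v = c at *
  generalize form a v v = A at *
  generalize (∑ i : Fin n, a i * x i.castSucc * v i.castSucc) = P at *
  generalize (∑ i : Fin n, a i * x i.castSucc ^ 2) = r at *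
  generalize (∑ i : Fin n, a i * v i.castSucc ^ 2) = w at *
  generalize v (Fin.last n) = s at *
  generalize x (Fin.last n) = X at *
  have h1 : s ^ 2 * (1 + r) = (P - c) ^ 2 := by rw [← hx.1, hP]; ring
  -- Cauchy–Schwarz gives `P² ≤ r w`, and the arithmetic-geometric mean inequality splits the cross
  -- term so that `(1 + r) s² ≤ (1 + 2r)(c² + w / 2)`.
  have h2 : -(2 * P * c) ≤ 2 * r * c ^ 2 + w / 2 := by
    refine (neg_le_abs _).trans (abs_le_of_sq_le_sq ?_ (by positivity))
    nlinarith [sq_nonneg (2 * r * c ^ 2 - w / 2), mul_le_mul_of_nonneg_left hCS (sq_nonneg c)]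
  rw [hx.1]
  subst hv
  nlinarith

/-- The compactness behind both uses of discreteness: it bounds the columns of elements fixing a
point, and the normals of walls that meet a bounded region. Once the last coordinate is bounded,
`form v v ≤ A` bounds the others. -/
theorem exists_abs_le_of_form {n : ℕ} {a : Fin n → ℝ} (ha : ∀ i, 0 < a i) (X c A : ℝ) :
    ∃ R, ∀ x ∈ hyperbolicSpace a, x (Fin.last n) ≤ X → ∀ v, |form a x v| ≤ c → form a v v ≤ A →
      ∀ k, |v k| ≤ R := by
  have hbd : ∃ S : ℝ, ∀ x ∈ hyperbolicSpace a, x (Fin.last n) ≤ X → ∀ v, |form a x v| ≤ c →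
      form a v v ≤ A → v (Fin.last n) ^ 2 ≤ S := by
    refine ⟨(2 * X ^ 2 - 1) * (2 * c ^ 2 + |A|), fun x hx hX v hc hA => ?_⟩
    refine (sq_last_le_of_form ha hx).trans ?_
    have h0 := mem_hyperbolicSpace_iff.1 hx
    have hr : 0 ≤ ∑ i : Fin n, a i * x i.castSucc ^ 2 :=
      Finset.sum_nonneg fun i _ => mul_nonneg (ha i).le (sq_nonneg _)
    have h1 : x (Fin.last n) ^ 2 ≤ X ^ 2 := by nlinarith [h0.2]
    have h2 : form a x v ^ 2 ≤ c ^ 2 := sq_le_sq' (neg_le_of_abs_le hc) (le_of_abs_le hc)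
    calc _ ≤ (2 * x (Fin.last n) ^ 2 - 1) * (2 * c ^ 2 + |A|) :=
          mul_le_mul_of_nonneg_left (by linarith [le_abs_self A]) (by linarith [h0.1])
      _ ≤ _ := mul_le_mul_of_nonneg_right (by linarith) (by positivity)
  obtain ⟨S, hS⟩ := hbd
  have key : ∀ k : Fin (n + 1), ∃ R : ℝ, ∀ x ∈ hyperbolicSpace a, x (Fin.last n) ≤ X →
      ∀ v, |form a x v| ≤ c → form a v v ≤ A → |v k| ≤ R := by
    intro k
    refine Fin.lastCases ?_ (fun i => ?_) k
    · exact ⟨√S, fun x hx hX v hc hA => Real.abs_le_sqrt (hS x hx hX v hc hA)⟩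
    · refine ⟨√((A + S) / a i), fun x hx hX v hc hA => Real.abs_le_sqrt ?_⟩
      rw [le_div_iff₀ (ha i)]
      have h1 := hS x hx hX v hc hA
      rw [form_apply] at hA
      have h2 : a i * v i.castSucc * v i.castSucc ≤ ∑ i, a i * v i.castSucc * v i.castSucc :=
        Finset.single_le_sum (f := fun i => a i * v i.castSucc * v i.castSucc)
          (fun i _ => by rw [mul_assoc]; exact mul_nonneg (ha i).le (mul_self_nonneg _))
          (Finset.mem_univ i)
      nlinarith
  choose R hR using key
  obtain ⟨M, hM⟩ := Finite.exists_le R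
  exact ⟨M, fun x hx hX v hc hA k => (hR k x hx hX v hc hA).trans (hM k)⟩

/-- The parametrization of hyperbolic space as a graph over `ℝⁿ`. -/
noncomputable def graphPoint {n : ℕ} (a : Fin n → ℝ) (y : Fin n → ℝ) : Fin (n + 1) → ℝ :=
  Fin.snoc (α := fun _ => ℝ) y √(1 + ∑ i, a i * y i ^ 2)

theorem continuous_graphPoint {n : ℕ} (a : Fin n → ℝ) : Continuous (graphPoint a) := by
  refine continuous_pi fun k => ?_
  refine Fin.lastCases ?_ (fun i => ?_) k
  · simp only [graphPoint, Fin.snoc_last]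
    fun_prop
  · simp only [graphPoint, Fin.snoc_castSucc]
    fun_prop

theorem graphPoint_mem {n : ℕ} {a : Fin n → ℝ} (ha : ∀ i, 0 < a i) (y : Fin n → ℝ) :
    graphPoint a y ∈ hyperbolicSpace a := by
  have hr : 0 ≤ ∑ i : Fin n, a i * y i ^ 2 :=
    Finset.sum_nonneg fun i _ => mul_nonneg (ha i).le (sq_nonneg _)
  rw [mem_hyperbolicSpace_iff]
  simp only [graphPoint, Fin.snoc_last, Fin.snoc_castSucc]
  exact ⟨Real.sq_sqrt (by linarith), Real.sqrt_pos.2 (by linarith)⟩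

theorem graphPoint_init {n : ℕ} {a : Fin n → ℝ} {x : Fin (n + 1) → ℝ}
    (hx : x ∈ hyperbolicSpace a) : graphPoint a (fun i => x i.castSucc) = x := by
  rw [mem_hyperbolicSpace_iff] at hx
  ext k
  refine Fin.lastCases ?_ (fun i => ?_) k
  · simp only [graphPoint, Fin.snoc_last]
    rw [← hx.1, Real.sqrt_sq hx.2.le]
  · simp only [graphPoint, Fin.snoc_castSucc]

theorem isPreconnected_hyperbolicSpace {n : ℕ} {a : Fin n → ℝ} (ha : ∀ i, 0 < a i) :
    IsPreconnected (hyperbolicSpace a) := by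
  have h : hyperbolicSpace a = Set.range (graphPoint a) := by
    ext x
    exact ⟨fun hx => ⟨_, graphPoint_init hx⟩, fun ⟨y, hy⟩ => hy ▸ graphPoint_mem ha y⟩
  rw [h]
  exact isPreconnected_range (continuous_graphPoint a)

/-- Every neighbourhood of a point of hyperbolic space contains, for a small ball of
the graph coordinates, all points of hyperbolic space with coordinates in that ball. -/
theorem exists_ball_graphPoint {n : ℕ} {a : Fin n → ℝ} {p : Fin (n + 1) → ℝ}
    (hp : p ∈ hyperbolicSpace a) {N : Set (Fin (n + 1) → ℝ)} (hN : N ∈ 𝓝 p) :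
    ∃ ε > 0, ∀ y ∈ Metric.ball (fun i : Fin n => p i.castSucc) ε, graphPoint a y ∈ N := by
  have h := (continuous_graphPoint a).continuousAt (x := fun i : Fin n => p i.castSucc)
  rw [ContinuousAt, graphPoint_init hp] at h
  exact Metric.mem_nhds_iff.1 (h hN)

theorem preimage_init_ball_mem_nhds {n : ℕ} (p : Fin (n + 1) → ℝ) {ε : ℝ} (hε : 0 < ε) :
    {x : Fin (n + 1) → ℝ | (fun i : Fin n => x i.castSucc) ∈
      Metric.ball (fun i : Fin n => p i.castSucc) ε} ∈ 𝓝 p := by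
  have h : Continuous fun (x : Fin (n + 1) → ℝ) (i : Fin n) => x i.castSucc := by fun_prop
  exact h.continuousAt (Metric.ball_mem_nhds _ hε)


/-! ### The action on the hyperboloid -/

/-- `Γ` preserves the form `formMatrix a`, and the columns of its elements form locally finite
sets; in particular `Γ` is discrete. -/
structure IsDiscreteIsometryGroup {n : ℕ} (a : Fin n → ℝ)
    (Γ : Subgroup (SLn (n + 1) ℝ)) : Prop where
  form_eq : ∀ γ ∈ Γ, (γ : Matrix (Fin (n + 1)) (Fin (n + 1)) ℝ)ᵀ * formMatrix a * γ = formMatrix a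
  finite_col : ∀ (i : Fin (n + 1)) (R : ℝ),
    {v : Fin (n + 1) → ℝ | (∃ γ ∈ Γ, (γ : Matrix (Fin (n + 1)) (Fin (n + 1)) ℝ).col i = v) ∧
      ∀ k, |v k| ≤ R}.Finite

theorem translate_mul {n : ℕ} (γ δ : SLn n ℝ) (S : Set (Fin n → ℝ)) :
    translate (γ * δ) S = translate γ (translate δ S) := by
  simp only [translate, Set.image_image, Matrix.SpecialLinearGroup.coe_mul, Matrix.mulVec_mulVec]

theorem translate_one {n : ℕ} (S : Set (Fin n → ℝ)) : translate 1 S = S := by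
  simp [translate]

theorem translate_eq_iff {n : ℕ} {γ : SLn n ℝ} {S T : Set (Fin n → ℝ)} :
    translate γ S = T ↔ S = translate γ⁻¹ T := by
  constructor
  · rintro rfl
    rw [← translate_mul, inv_mul_cancel, translate_one]
  · rintro rfl
    rw [← translate_mul, mul_inv_cancel, translate_one]

theorem inv_mulVec_mulVec {n : ℕ} (γ : SLn n ℝ) (x : Fin n → ℝ) :
    ((γ⁻¹ : SLn n ℝ) : Matrix (Fin n) (Fin n) ℝ) *ᵥ ((γ : Matrix (Fin n) (Fin n) ℝ) *ᵥ x) = x := by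
  rw [Matrix.mulVec_mulVec, ← Matrix.SpecialLinearGroup.coe_mul, inv_mul_cancel,
    Matrix.SpecialLinearGroup.coe_one, Matrix.one_mulVec]

theorem mulVec_inv_mulVec {n : ℕ} (γ : SLn n ℝ) (x : Fin n → ℝ) :
    (γ : Matrix (Fin n) (Fin n) ℝ) *ᵥ (((γ⁻¹ : SLn n ℝ) : Matrix (Fin n) (Fin n) ℝ) *ᵥ x) = x := by
  simpa using inv_mulVec_mulVec γ⁻¹ x

theorem mem_translate {n : ℕ} {γ : SLn n ℝ} {S : Set (Fin n → ℝ)} {x : Fin n → ℝ} :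
    x ∈ translate γ S ↔ ((γ⁻¹ : SLn n ℝ) : Matrix (Fin n) (Fin n) ℝ) *ᵥ x ∈ S := by
  constructor
  · rintro ⟨y, hy, rfl⟩
    simpa only [inv_mulVec_mulVec] using hy
  · exact fun h => ⟨_, h, mulVec_inv_mulVec γ x⟩

/-- The action of `γ` on `ℝⁿ` as a homeomorphism. -/
noncomputable def actHomeomorph {n : ℕ} (γ : SLn n ℝ) : (Fin n → ℝ) ≃ₜ (Fin n → ℝ) where
  toFun x := (γ : Matrix (Fin n) (Fin n) ℝ) *ᵥ x
  invFun x := ((γ⁻¹ : SLn n ℝ) : Matrix (Fin n) (Fin n) ℝ) *ᵥ x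
  left_inv := inv_mulVec_mulVec γ
  right_inv := mulVec_inv_mulVec γ
  continuous_toFun := Continuous.matrix_mulVec continuous_const continuous_id
  continuous_invFun := Continuous.matrix_mulVec continuous_const continuous_id

theorem form_single_zero {m : ℕ} (a : Fin (m + 1) → ℝ) (x : Fin (m + 2) → ℝ) :
    form a x (Pi.single 0 1) = a 0 * x 0 := by
  rw [form_apply, Finset.sum_eq_single 0]
  · simp [Fin.ext_iff]
  · intro i _ hi
    have h : i.castSucc ≠ (0 : Fin (m + 2)) := fun h => hi (Fin.castSucc_injective _ h)
    rw [Pi.single_eq_of_ne h, mul_zero]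
  · simp

/-! ### Walls and chambers -/

section Walls

variable {m : ℕ} {a : Fin (m + 1) → ℝ} {Γ : Subgroup (SLn (m + 2) ℝ)}
  {Γ₁ : Subgroup (SLn (m + 1) ℝ)}

theorem mem_wall_iff (ha : ∀ i, 0 < a i) {x : Fin (m + 2) → ℝ} :
    x ∈ wall a ↔ x ∈ hyperbolicSpace a ∧ form a x (Pi.single 0 1) = 0 := by
  rw [form_single_zero]
  simp [wall, (ha 0).ne']

theorem mem_translate_hyperbolicSpace (hM : IsManifoldGroup a Γ) {γ : SLn (m + 2) ℝ} (hγ : γ ∈ Γ)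
    {x : Fin (m + 2) → ℝ} :
    (γ : Matrix (Fin (m + 2)) (Fin (m + 2)) ℝ) *ᵥ x ∈ hyperbolicSpace a ↔
      x ∈ hyperbolicSpace a := by
  have h := hM.translate_eq _ (inv_mem hγ)
  conv_rhs => rw [← h, mem_translate, inv_inv]

/-- The wall is orthogonal to the first basis vector, so its translate by `γ` is orthogonal to
column `0` of `γ`. Local finiteness of walls thus becomes finiteness of columns. -/
theorem mem_translate_wall_iff (ha : ∀ i, 0 < a i) (hΓ : IsDiscreteIsometryGroup a Γ)
    (hM : IsManifoldGroup a Γ) {γ : SLn (m + 2) ℝ} (hγ : γ ∈ Γ) {x : Fin (m + 2) → ℝ} :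
    x ∈ translate γ (wall a) ↔ x ∈ hyperbolicSpace a ∧
      form a x ((γ : Matrix (Fin (m + 2)) (Fin (m + 2)) ℝ).col 0) = 0 := by
  rw [mem_translate, mem_wall_iff ha, mem_translate_hyperbolicSpace hM (inv_mem hγ),
    ← form_mulVec (hΓ.form_eq γ hγ), mulVec_inv_mulVec, Matrix.mulVec_single_one]

/-- Powers of `γ` fix `x` and preserve the form, so their columns have the same norms and the same
products with `x` as the basis vectors. They are therefore bounded, and discreteness leaves finitely
many powers. -/
theorem isOfFinOrder_of_mulVec_eq (ha : ∀ i, 0 < a i) (hΓ : IsDiscreteIsometryGroup a Γ)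
    {γ : SLn (m + 2) ℝ} (hγ : γ ∈ Γ) {x : Fin (m + 2) → ℝ} (hx : x ∈ hyperbolicSpace a)
    (hγx : (γ : Matrix (Fin (m + 2)) (Fin (m + 2)) ℝ) *ᵥ x = x) : IsOfFinOrder γ := by
  rw [← finite_powers]
  have hcol : ∀ i : Fin (m + 2), ∃ R : ℝ, ∀ δ ∈ Submonoid.powers γ, ∀ k,
      |(δ : Matrix (Fin (m + 2)) (Fin (m + 2)) ℝ).col i k| ≤ R := by
    intro i
    obtain ⟨R, hR⟩ := exists_abs_le_of_form ha (x (Fin.last _)) |form a x (Pi.single i 1)|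
      (form a (Pi.single i 1) (Pi.single i 1))
    refine ⟨R, ?_⟩
    rintro δ ⟨k, rfl⟩
    have hk : ((γ ^ k : SLn (m + 2) ℝ) : Matrix (Fin (m + 2)) (Fin (m + 2)) ℝ) *ᵥ x = x := by
      induction k with
      | zero => simp
      | succ k ih =>
        rw [pow_succ, Matrix.SpecialLinearGroup.coe_mul, ← Matrix.mulVec_mulVec, hγx, ih]
    have hf := hΓ.form_eq _ (pow_mem hγ k)
    refine hR x hx le_rfl _ (le_of_eq ?_) (le_of_eq ?_)
    · conv_lhs => rw [← hk]
      rw [← Matrix.mulVec_single_one, form_mulVec hf]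
    · rw [← Matrix.mulVec_single_one, form_mulVec hf]
  choose R hR using hcol
  refine Set.Finite.of_finite_image (f := fun δ : SLn (m + 2) ℝ =>
    fun i => (δ : Matrix (Fin (m + 2)) (Fin (m + 2)) ℝ).col i) ?_ ?_
  · refine (Set.Finite.pi' fun i => hΓ.finite_col i (R i)).subset ?_
    rintro _ ⟨δ, hδ, rfl⟩ i
    exact ⟨⟨δ, (Submonoid.powers_le.2 hγ : _ ≤ Γ.toSubmonoid) hδ, rfl⟩, hR i δ hδ⟩
  · intro δ _ δ' _ h
    ext i j
    exact congrFun (congrFun h j) i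

theorem block_mulVec_zero {n : ℕ} (δ : SLn n ℝ) (x : Fin (n + 1) → ℝ) :
    ((block δ : SLn (n + 1) ℝ) : Matrix (Fin (n + 1)) (Fin (n + 1)) ℝ).mulVec x 0 = x 0 := by
  simp [block, blockMatrix, Matrix.mulVec, dotProduct, Fin.sum_univ_succ]

/-- Translates of the wall that meet the wall coincide with it. -/
theorem translate_wall_subset (ha : ∀ i, 0 < a i) (hΓ : IsDiscreteIsometryGroup a Γ)
    (hM : IsManifoldGroup a Γ) (hM₁ : IsEmbeddedHypersurface a Γ Γ₁)
    {γ : SLn (m + 2) ℝ} (hγ : γ ∈ Γ) {p : Fin (m + 2) → ℝ} (hp : p ∈ wall a)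
    (hpγ : p ∈ translate γ (wall a)) : translate γ (wall a) ⊆ wall a := by
  obtain ⟨x, hx, hxp⟩ := hpγ
  obtain ⟨δ, hδ, hδx⟩ := hM₁.injective x hx p hp γ hγ hxp
  have hδΓ := hM₁.block_mem δ hδ
  -- An element fixing a point of hyperbolic space has finite order, hence is trivial; so `γ` is
  -- `block δ`, which preserves the first coordinate.
  have hfix : (((block δ)⁻¹ * γ : SLn (m + 2) ℝ) : Matrix (Fin (m + 2)) (Fin (m + 2)) ℝ) *ᵥ x
      = x := by
    simp only at hxp
    rw [Matrix.SpecialLinearGroup.coe_mul, ← Matrix.mulVec_mulVec, hxp, ← hδx, inv_mulVec_mulVec]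
  have h1 := hM.torsionFree _ (mul_mem (inv_mem hδΓ) hγ)
    (isOfFinOrder_of_mulVec_eq ha hΓ (mul_mem (inv_mem hδΓ) hγ) hx.1 hfix)
  obtain rfl : block δ = γ := inv_mul_eq_one.1 h1
  rintro _ ⟨y, hy, rfl⟩
  exact ⟨(mem_translate_hyperbolicSpace hM hγ).2 hy.1, (block_mulVec_zero δ y).trans hy.2⟩

/-- Near a point of hyperbolic space, the translates of the wall that do not contain the point
can be avoided. -/
theorem exists_nhds_disjoint_translate_wall (ha : ∀ i, 0 < a i)
    (hΓ : IsDiscreteIsometryGroup a Γ) (hM : IsManifoldGroup a Γ)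
    {p : Fin (m + 2) → ℝ} (hp : p ∈ hyperbolicSpace a) :
    ∃ N ∈ 𝓝 p, ∀ γ ∈ Γ, p ∉ translate γ (wall a) → Disjoint N (translate γ (wall a)) := by
  -- The height stays below that of `p` plus `1` near `p`; a normal is orthogonal to the points of
  -- its wall (`0`) and has the norm of the first basis vector. Only the finitely many normals in
  -- `V` can matter.
  obtain ⟨R, hR⟩ := exists_abs_le_of_form ha (p (Fin.last _) + 1) 0
    (form a (Pi.single 0 1) (Pi.single 0 1))
  set V := {v : Fin (m + 2) → ℝ |
    (∃ γ ∈ Γ, (γ : Matrix (Fin (m + 2)) (Fin (m + 2)) ℝ).col 0 = v) ∧ ∀ k, |v k| ≤ R}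
  have hfin : V.Finite := hΓ.finite_col 0 R
  have h1 : {x : Fin (m + 2) → ℝ | x (Fin.last _) < p (Fin.last _) + 1} ∈ 𝓝 p :=
    (isOpen_lt (continuous_apply _) continuous_const).mem_nhds (by simp)
  have h2 : (⋂ v ∈ V, {x : Fin (m + 2) → ℝ | form a p v ≠ 0 → form a x v ≠ 0}) ∈ 𝓝 p := by
    rw [Filter.biInter_mem hfin]
    intro v _
    by_cases h : form a p v = 0
    · simp [h]
    · exact ((continuous_form_left a v).continuousAt.eventually_ne h).mono fun _ h _ => h
  refine ⟨_, Filter.inter_mem h1 h2, fun γ hγ hpγ => Set.disjoint_left.2 fun x hx hxγ => ?_⟩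
  rw [mem_translate_wall_iff ha hΓ hM hγ] at hpγ hxγ
  have hv : (γ : Matrix (Fin (m + 2)) (Fin (m + 2)) ℝ).col 0 ∈ V := by
    refine ⟨⟨γ, hγ, rfl⟩, hR x hxγ.1 (le_of_lt hx.1) _ (by rw [hxγ.2, abs_zero]) ?_⟩
    rw [← Matrix.mulVec_single_one, form_mulVec (hΓ.form_eq γ hγ)]
  have := Set.mem_iInter₂.1 hx.2 _ hv
  exact this (fun h => hpγ ⟨hp, h⟩) hxγ.2

theorem translate_cutSpace (hM : IsManifoldGroup a Γ) {γ : SLn (m + 2) ℝ} (hγ : γ ∈ Γ) :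
    translate γ (cutSpace a Γ) = cutSpace a Γ := by
  have key : ∀ γ ∈ Γ, ∀ x ∈ cutSpace a Γ,
      (γ : Matrix (Fin (m + 2)) (Fin (m + 2)) ℝ) *ᵥ x ∈ cutSpace a Γ := by
    intro γ hγ x hx
    refine ⟨(mem_translate_hyperbolicSpace hM hγ).2 hx.1, fun h => hx.2 ?_⟩
    simp only [Set.mem_iUnion] at h ⊢
    obtain ⟨δ, hδ, hx'⟩ := h
    refine ⟨γ⁻¹ * δ, mul_mem (inv_mem hγ) hδ, ?_⟩
    rw [translate_mul, mem_translate, inv_inv]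
    exact hx'
  refine Set.Subset.antisymm ?_ fun x hx => mem_translate.2 (key _ (inv_mem hγ) x hx)
  rintro _ ⟨x, hx, rfl⟩
  exact key γ hγ x hx

theorem translate_connectedComponentIn (hM : IsManifoldGroup a Γ) {γ : SLn (m + 2) ℝ}
    (hγ : γ ∈ Γ) {x : Fin (m + 2) → ℝ} (hx : x ∈ cutSpace a Γ) :
    translate γ (connectedComponentIn (cutSpace a Γ) x) =
      connectedComponentIn (cutSpace a Γ) ((γ : Matrix (Fin (m + 2)) (Fin (m + 2)) ℝ) *ᵥ x) := by
  have h := (actHomeomorph γ).image_connectedComponentIn hx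
  have hc : actHomeomorph γ '' cutSpace a Γ = cutSpace a Γ := translate_cutSpace hM hγ
  rw [hc] at h
  exact h

theorem IsChamber.translate (hM : IsManifoldGroup a Γ) {γ : SLn (m + 2) ℝ}
    (hγ : γ ∈ Γ) {C : Set (Fin (m + 2) → ℝ)} (hC : IsChamber a Γ C) :
    IsChamber a Γ (translate γ C) := by
  obtain ⟨x, hx, rfl⟩ := hC
  refine ⟨(γ : Matrix (Fin (m + 2)) (Fin (m + 2)) ℝ) *ᵥ x, ?_,
    translate_connectedComponentIn hM hγ hx⟩
  rw [← translate_cutSpace hM hγ]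
  exact ⟨x, hx, rfl⟩

theorem IsChamber.eq_connectedComponentIn {C : Set (Fin (m + 2) → ℝ)} (hC : IsChamber a Γ C)
    {x : Fin (m + 2) → ℝ} (hx : x ∈ C) : C = connectedComponentIn (cutSpace a Γ) x := by
  obtain ⟨y, hy, rfl⟩ := hC
  exact connectedComponentIn_eq hx

theorem IsChamber.subset_cutSpace {C : Set (Fin (m + 2) → ℝ)} (hC : IsChamber a Γ C) :
    C ⊆ cutSpace a Γ := by
  obtain ⟨y, hy, rfl⟩ := hC
  exact connectedComponentIn_subset _ _

/-- The part of the hyperboloid over a small coordinate ball is connected and meets no wall. -/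
theorem exists_nhds_connectedComponentIn_eq (ha : ∀ i, 0 < a i)
    (hΓ : IsDiscreteIsometryGroup a Γ) (hM : IsManifoldGroup a Γ)
    {p : Fin (m + 2) → ℝ} (hp : p ∈ cutSpace a Γ) :
    ∃ N ∈ 𝓝 p, ∀ x ∈ N, x ∈ cutSpace a Γ →
      connectedComponentIn (cutSpace a Γ) x = connectedComponentIn (cutSpace a Γ) p := by
  obtain ⟨N, hN, hdisj⟩ := exists_nhds_disjoint_translate_wall ha hΓ hM hp.1
  obtain ⟨ε, hε, hball⟩ := exists_ball_graphPoint hp.1 hN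
  refine ⟨_, preimage_init_ball_mem_nhds p hε, fun x hx hxc => ?_⟩
  set B := graphPoint a '' Metric.ball (fun i => p i.castSucc) ε
  have hB : IsPreconnected B := ((convex_ball _ _).isPreconnected).image _
    (continuous_graphPoint a).continuousOn
  have hBc : B ⊆ cutSpace a Γ := by
    rintro _ ⟨y, hy, rfl⟩
    refine ⟨graphPoint_mem ha y, fun h => ?_⟩
    simp only [Set.mem_iUnion] at h
    obtain ⟨γ, hγ, h⟩ := h
    refine Set.disjoint_left.1 (hdisj γ hγ fun h' => hp.2 ?_) (hball y hy) h
    exact Set.mem_biUnion hγ h'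
  have hpB : p ∈ B := ⟨_, Metric.mem_ball_self hε, graphPoint_init hp.1⟩
  have hxB : x ∈ B := ⟨_, hx, graphPoint_init hxc.1⟩
  exact (connectedComponentIn_eq (hB.subset_connectedComponentIn hpB hBc hxB)).symm

/-- Near a point of the wall there are only the two chambers on the two sides of the wall. -/
theorem AreSides.exists_nhds (ha : ∀ i, 0 < a i) (hΓ : IsDiscreteIsometryGroup a Γ)
    (hM : IsManifoldGroup a Γ) (hM₁ : IsEmbeddedHypersurface a Γ Γ₁)
    {C₁ C₂ : Set (Fin (m + 2) → ℝ)} (hC : AreSides a Γ C₁ C₂)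
    {p : Fin (m + 2) → ℝ} (hp : p ∈ wall a) :
    ∃ N ∈ 𝓝 p, ∀ x ∈ N, x ∈ cutSpace a Γ → x ∈ C₁ ∨ x ∈ C₂ := by
  obtain ⟨N, hN, hdisj⟩ := exists_nhds_disjoint_translate_wall ha hΓ hM hp.1
  obtain ⟨ε, hε, hball⟩ := exists_ball_graphPoint hp.1 hN
  have hN' := preimage_init_ball_mem_nhds p hε
  refine ⟨_, hN', ?_⟩
  set N' := {x : Fin (m + 2) → ℝ | (fun i : Fin (m + 1) => x i.castSucc) ∈
      Metric.ball (fun i : Fin (m + 1) => p i.castSucc) ε}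
  -- Walls entering the ball pass through `p` and so lie in `x 0 = 0`. Each open half of the ball is
  -- thus connected inside the cut space.
  have hside : ∀ S : Set ℝ, Convex ℝ S → (0 : ℝ) ∉ S →
      ∀ x ∈ N' ∩ hyperbolicSpace a, ∀ z ∈ N' ∩ hyperbolicSpace a, x 0 ∈ S → z 0 ∈ S →
        connectedComponentIn (cutSpace a Γ) x = connectedComponentIn (cutSpace a Γ) z := by
    intro S hS h0 x hx z hz hxS hzS
    set B := graphPoint a '' (Metric.ball (fun i => p i.castSucc) ε ∩ (fun y => y 0) ⁻¹' S)
    have hB : IsPreconnected B := by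
      refine IsPreconnected.image (Convex.isPreconnected ?_) _ (continuous_graphPoint a).continuousOn
      exact (convex_ball _ _).inter
        (hS.linear_preimage (LinearMap.proj (R := ℝ) (φ := fun _ : Fin (m + 1) => ℝ) 0))
    have hBc : B ⊆ cutSpace a Γ := by
      rintro _ ⟨y, ⟨hy, hyS⟩, rfl⟩
      refine ⟨graphPoint_mem ha y, fun h => ?_⟩
      simp only [Set.mem_iUnion] at h
      obtain ⟨γ, hγ, h⟩ := h
      have hpγ : p ∈ translate γ (wall a) := by
        by_contra hpγ
        exact Set.disjoint_left.1 (hdisj γ hγ hpγ) (hball y hy) h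
      have hw := (translate_wall_subset ha hΓ hM hM₁ hγ hp hpγ h).2
      have hy0 : graphPoint a y 0 = y 0 := Fin.snoc_castSucc (α := fun _ => ℝ) (i := 0) _ _
      rw [hy0] at hw
      exact h0 (hw ▸ hyS)
    have hxB : x ∈ B := ⟨_, ⟨hx.1, hxS⟩, graphPoint_init hx.2⟩
    have hzB : z ∈ B := ⟨_, ⟨hz.1, hzS⟩, graphPoint_init hz.2⟩
    exact connectedComponentIn_eq (hB.subset_connectedComponentIn hxB hBc hzB)
  have hne : ∀ x ∈ cutSpace a Γ, x 0 < 0 ∨ 0 < x 0 := by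
    intro x hx
    refine lt_or_gt_of_ne fun h => hx.2 (Set.mem_biUnion Γ.one_mem ?_)
    rw [translate_one]
    exact ⟨hx.1, h⟩
  have hneg := hside (Set.Iio 0) (convex_Iio 0) (by simp)
  have hpos := hside (Set.Ioi 0) (convex_Ioi 0) (by simp)
  -- Both chambers reach the ball, and being distinct they occupy opposite halves; together they
  -- exhaust it off the wall.
  obtain ⟨z₁, hz₁N, hz₁⟩ := mem_closure_iff_nhds.1 (hC.wall_subset₁ hp) _ hN'
  obtain ⟨z₂, hz₂N, hz₂⟩ := mem_closure_iff_nhds.1 (hC.wall_subset₂ hp) _ hN'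
  have hc₁ := hC.chamber₁.subset_cutSpace hz₁
  have hc₂ := hC.chamber₂.subset_cutSpace hz₂
  have e₁ := hC.chamber₁.eq_connectedComponentIn hz₁
  have e₂ := hC.chamber₂.eq_connectedComponentIn hz₂
  have hne' := hC.ne
  rw [e₁, e₂] at hne' ⊢
  intro x hxN hx
  have hself := mem_connectedComponentIn hx
  rcases hne z₁ hc₁ with h₁ | h₁ <;> rcases hne z₂ hc₂ with h₂ | h₂ <;>
    rcases hne x hx with h | h
  · exact absurd (hneg _ ⟨hz₁N, hc₁.1⟩ _ ⟨hz₂N, hc₂.1⟩ h₁ h₂) hne'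
  · exact absurd (hneg _ ⟨hz₁N, hc₁.1⟩ _ ⟨hz₂N, hc₂.1⟩ h₁ h₂) hne'
  · exact .inl (hneg _ ⟨hxN, hx.1⟩ _ ⟨hz₁N, hc₁.1⟩ h h₁ ▸ hself)
  · exact .inr (hpos _ ⟨hxN, hx.1⟩ _ ⟨hz₂N, hc₂.1⟩ h h₂ ▸ hself)
  · exact .inr (hneg _ ⟨hxN, hx.1⟩ _ ⟨hz₂N, hc₂.1⟩ h h₂ ▸ hself)
  · exact .inl (hpos _ ⟨hxN, hx.1⟩ _ ⟨hz₁N, hc₁.1⟩ h h₁ ▸ hself)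
  · exact absurd (hpos _ ⟨hz₁N, hc₁.1⟩ _ ⟨hz₂N, hc₂.1⟩ h₁ h₂) hne'
  · exact absurd (hpos _ ⟨hz₁N, hc₁.1⟩ _ ⟨hz₂N, hc₂.1⟩ h₁ h₂) hne'

/-! ### Generation of `Γ` by wall crossing -/

/-- A property of chambers that holds for `C₁` and propagates across every translate of the wall
holds for all chambers. -/
theorem AreSides.chamber_induction (ha : ∀ i, 0 < a i) (hΓ : IsDiscreteIsometryGroup a Γ)
    (hM : IsManifoldGroup a Γ) (hM₁ : IsEmbeddedHypersurface a Γ Γ₁)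
    {C₁ C₂ : Set (Fin (m + 2) → ℝ)} (hC : AreSides a Γ C₁ C₂)
    (P : Set (Fin (m + 2) → ℝ) → Prop) (h₁ : P C₁)
    (hP : ∀ γ ∈ Γ, P (Bending.translate γ C₁) ↔ P (Bending.translate γ C₂))
    {C : Set (Fin (m + 2) → ℝ)} (h : IsChamber a Γ C) : P C := by
  set T := cutSpace a Γ with hT
  -- The truth value of `P` is locally constant: away from walls one chamber is visible, and on the
  -- `γ`-translate of the wall only those of `C₁` and `C₂`, which `hP` relates.
  have hlocal : ∀ p ∈ hyperbolicSpace a, ∃ N ∈ 𝓝 p, ∃ y ∈ T, ∀ x ∈ N, x ∈ T →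
      (P (connectedComponentIn T x) ↔ P (connectedComponentIn T y)) := by
    intro p hp
    by_cases hpT : p ∈ T
    · obtain ⟨N, hN, hx⟩ := exists_nhds_connectedComponentIn_eq ha hΓ hM hpT
      exact ⟨N, hN, p, hpT, fun x hxN hxT => by rw [hx x hxN hxT]⟩
    · have : p ∈ ⋃ γ ∈ Γ, Bending.translate γ (wall a) := by
        by_contra h'
        exact hpT ⟨hp, h'⟩
      simp only [Set.mem_iUnion] at this
      obtain ⟨γ, hγ, hpγ⟩ := this
      rw [mem_translate] at hpγ
      obtain ⟨N, hN, hx⟩ := hC.exists_nhds ha hΓ hM hM₁ hpγ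
      have hch₁ := hC.chamber₁.translate hM hγ
      have hch₂ := hC.chamber₂.translate hM hγ
      obtain ⟨y, hyT, hy⟩ := id hch₁
      refine ⟨_, (actHomeomorph γ).symm.continuous.continuousAt hN, y, hyT, fun x hxN hxT => ?_⟩
      have hxT' : ((γ⁻¹ : SLn (m + 2) ℝ) : Matrix (Fin (m + 2)) (Fin (m + 2)) ℝ) *ᵥ x ∈ T := by
        rw [← mem_translate, translate_cutSpace hM hγ]
        exact hxT
      rw [← hy]
      rcases hx _ hxN hxT' with h | h <;> replace h := mem_translate.2 h
      · rw [hch₁.eq_connectedComponentIn h]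
      · rw [← hch₂.eq_connectedComponentIn h, hP γ hγ]
  -- Density of the cut space puts a chamber point in any overlap of the two open sets `U True` and
  -- `U False`, where it is contradictory.
  have hdense : ∀ p ∈ hyperbolicSpace a, ∀ N ∈ 𝓝 p, ∃ x ∈ N, x ∈ T := by
    intro p hp N hN
    by_cases hpT : p ∈ T
    · exact ⟨p, mem_of_mem_nhds hN, hpT⟩
    · have : p ∈ ⋃ γ ∈ Γ, Bending.translate γ (wall a) := by
        by_contra h'
        exact hpT ⟨hp, h'⟩
      simp only [Set.mem_iUnion] at this
      obtain ⟨γ, hγ, q, hq, rfl⟩ := this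
      obtain ⟨z, hzN, hz⟩ := mem_closure_iff_nhds.1 (hC.wall_subset₁ hq) _
        ((actHomeomorph γ).continuous.continuousAt hN)
      refine ⟨_, hzN, ?_⟩
      rw [hT, ← translate_cutSpace hM hγ]
      exact ⟨z, hC.chamber₁.subset_cutSpace hz, rfl⟩
  let U : Prop → Set (Fin (m + 2) → ℝ) := fun b =>
    interior {x | x ∈ T → (P (connectedComponentIn T x) ↔ b)}
  obtain ⟨y, hyT, rfl⟩ := h
  by_contra hy
  obtain ⟨x, hxT, hx⟩ := hC.chamber₁
  have hcover : ∀ p ∈ hyperbolicSpace a, p ∈ U True ∨ p ∈ U False := by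
    intro p hp
    obtain ⟨N, hN, z, hzT, hz⟩ := hlocal p hp
    by_cases hPz : P (connectedComponentIn T z)
    · exact .inl (mem_interior_iff_mem_nhds.2 (Filter.mem_of_superset hN fun x hxN hxT =>
        (hz x hxN hxT).trans (iff_true_intro hPz)))
    · exact .inr (mem_interior_iff_mem_nhds.2 (Filter.mem_of_superset hN fun x hxN hxT =>
        (hz x hxN hxT).trans (iff_false_intro hPz)))
  have hxU : x ∈ U True := (hcover x hxT.1).resolve_right fun h =>
    (interior_subset h hxT).1 (hx ▸ h₁)
  have hyU : y ∈ U False := (hcover y hyT.1).resolve_left fun h =>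
    hy ((interior_subset h hyT).2 trivial)
  obtain ⟨z, hz, hzU⟩ := isPreconnected_hyperbolicSpace ha (U True) (U False) isOpen_interior
    isOpen_interior (fun p hp => hcover p hp) ⟨x, hxT.1, hxU⟩ ⟨y, hyT.1, hyU⟩
  obtain ⟨w, hwU, hwT⟩ := hdense z hz _ ((isOpen_interior.inter isOpen_interior).mem_nhds hzU)
  exact (interior_subset hwU.2 hwT).1 ((interior_subset hwU.1 hwT).2 trivial)

/-- If `M₁` separates `M`, the stabilizers of the two sides generate `Γ`. -/
theorem AreSides.eq_top_of_isSeparating (ha : ∀ i, 0 < a i) (hΓ : IsDiscreteIsometryGroup a Γ)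
    (hM : IsManifoldGroup a Γ) (hM₁ : IsEmbeddedHypersurface a Γ Γ₁)
    {C₁ C₂ : Set (Fin (m + 2) → ℝ)} (hC : AreSides a Γ C₁ C₂) (hsep : IsSeparating a Γ)
    (H : Subgroup Γ)
    (h₁ : ∀ γ : Γ, Bending.translate (γ : SLn (m + 2) ℝ) C₁ = C₁ → γ ∈ H)
    (h₂ : ∀ γ : Γ, Bending.translate (γ : SLn (m + 2) ℝ) C₂ = C₂ → γ ∈ H) : H = ⊤ := by
  -- If `Γ` carried `C₁` to `C₂`, every crossing would stay in the orbit of `C₁`, and `Γ` would be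
  -- transitive on chambers.
  have hne : ∀ γ ∈ Γ, Bending.translate γ C₁ ≠ C₂ := by
    intro σ hσ hσC
    have horbit : ∀ C, IsChamber a Γ C → ∃ γ ∈ Γ, Bending.translate γ C₁ = C := fun C h =>
      hC.chamber_induction ha hΓ hM hM₁ (fun C => ∃ γ ∈ Γ, Bending.translate γ C₁ = C)
        ⟨1, one_mem _, translate_one _⟩
        (fun γ hγ => iff_of_true ⟨γ, hγ, rfl⟩
          ⟨γ * σ, mul_mem hγ hσ, by rw [translate_mul, hσC]⟩) h
    refine hsep fun C C' h h' => ?_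
    obtain ⟨γ, hγ, rfl⟩ := horbit C h
    obtain ⟨γ', hγ', rfl⟩ := horbit C' h'
    exact ⟨γ' * γ⁻¹, mul_mem hγ' (inv_mem hγ), by rw [← translate_mul, inv_mul_cancel_right]⟩
  have key : ∀ {D : Set (Fin (m + 2) → ℝ)} (γ δ : Γ), δ ∈ H →
      (∀ γ : Γ, Bending.translate (γ : SLn (m + 2) ℝ) D = D → γ ∈ H) →
      Bending.translate (γ : SLn (m + 2) ℝ) D = Bending.translate (δ : SLn (m + 2) ℝ) D →
      γ ∈ H := by
    intro D γ δ hδ hD h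
    rw [eq_comm, translate_eq_iff, ← translate_mul, eq_comm] at h
    have h' := mul_mem hδ (hD (δ⁻¹ * γ) h)
    rwa [mul_inv_cancel_left] at h'
  -- By `hne`, a translate of `C₁` satisfying `P` must be an `H`-translate of `C₁`, and likewise for
  -- `C₂`. As `H` contains both stabilizers, the translating element is in `H`, so `P` crosses
  -- walls.
  let P : Set (Fin (m + 2) → ℝ) → Prop := fun C => ∃ δ ∈ H,
    Bending.translate ((δ : Γ) : SLn (m + 2) ℝ) C₁ = C ∨
      Bending.translate ((δ : Γ) : SLn (m + 2) ℝ) C₂ = C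
  have hP₁ : ∀ γ : Γ, P (Bending.translate (γ : SLn (m + 2) ℝ) C₁) → γ ∈ H := by
    rintro γ ⟨δ, hδ, h | h⟩
    · exact key γ δ hδ h₁ h.symm
    · rw [translate_eq_iff, ← translate_mul] at h
      exact absurd h.symm (hne _ (δ⁻¹ * γ).2)
  have hP₂ : ∀ γ : Γ, P (Bending.translate (γ : SLn (m + 2) ℝ) C₂) → γ ∈ H := by
    rintro γ ⟨δ, hδ, h | h⟩
    · rw [eq_comm, translate_eq_iff, ← translate_mul] at h
      exact absurd h.symm (hne _ (γ⁻¹ * δ).2)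
    · exact key γ δ hδ h₂ h.symm
  refine (eq_top_iff).2 fun γ _ => hP₁ γ ?_
  refine hC.chamber_induction ha hΓ hM hM₁ P ⟨1, one_mem _, .inl (translate_one _)⟩ ?_
    (hC.chamber₁.translate hM γ.2)
  exact fun γ hγ => ⟨fun h => ⟨⟨γ, hγ⟩, hP₁ ⟨γ, hγ⟩ h, .inr rfl⟩,
    fun h => ⟨⟨γ, hγ⟩, hP₂ ⟨γ, hγ⟩ h, .inl rfl⟩⟩

/-- The stabilizer of one side and an element that carries it to the other side generate `Γ`. -/
theorem AreSides.eq_top_of_translate_eq (ha : ∀ i, 0 < a i) (hΓ : IsDiscreteIsometryGroup a Γ)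
    (hM : IsManifoldGroup a Γ) (hM₁ : IsEmbeddedHypersurface a Γ Γ₁)
    {C₁ C₂ : Set (Fin (m + 2) → ℝ)} (hC : AreSides a Γ C₁ C₂) (H : Subgroup Γ)
    (h₁ : ∀ γ : Γ, Bending.translate (γ : SLn (m + 2) ℝ) C₁ = C₁ → γ ∈ H)
    {s : Γ} (hs : s ∈ H) (hsC : Bending.translate (s : SLn (m + 2) ℝ) C₁ = C₂) : H = ⊤ := by
  -- Crossing from `γ C₁` to `γ C₂ = γ s C₁` multiplies by `s ∈ H`, which does not affect membership
  -- in `H`.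
  let P : Set (Fin (m + 2) → ℝ) → Prop := fun C => ∃ δ ∈ H,
    Bending.translate ((δ : Γ) : SLn (m + 2) ℝ) C₁ = C
  have hP : ∀ γ : Γ, P (Bending.translate (γ : SLn (m + 2) ℝ) C₁) ↔ γ ∈ H := by
    refine fun γ => ⟨?_, fun h => ⟨γ, h, rfl⟩⟩
    rintro ⟨δ, hδ, h⟩
    rw [translate_eq_iff, ← translate_mul, eq_comm] at h
    have h' := mul_mem hδ (h₁ (δ⁻¹ * γ) h)
    rwa [mul_inv_cancel_left] at h'
  refine (eq_top_iff).2 fun γ _ => (hP γ).1 ?_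
  refine hC.chamber_induction ha hΓ hM hM₁ P ⟨1, one_mem _, translate_one _⟩ ?_
    (hC.chamber₁.translate hM γ.2)
  intro γ hγ
  have h₂ : Bending.translate γ C₂ = Bending.translate ((⟨γ, hγ⟩ * s : Γ) : SLn (m + 2) ℝ) C₁ := by
    rw [Subgroup.coe_mul, translate_mul, hsC]
  rw [h₂, hP ⟨γ, hγ⟩, hP]
  exact (Subgroup.mul_mem_cancel_right H hs).symm

end Walls


/-! ### Integrality: discreteness and unitarity -/

open NumberField

theorem map_form {R S : Type*} [CommRing R] [CommRing S] (f : R →+* S) {n : ℕ} (a : Fin n → R)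
    (x y : Fin (n + 1) → R) :
    f (form a x y) = form (fun i => f (a i)) (fun i => f (x i)) (fun i => f (y i)) := by
  simp [form_apply]

theorem formMatrix_map {R S : Type*} [CommRing R] [CommRing S] (f : R →+* S) {n : ℕ}
    (a : Fin n → R) : (formMatrix a).map f = formMatrix fun i => f (a i) := by
  rw [formMatrix, formMatrix, Matrix.diagonal_map (map_zero f)]
  congr 1
  ext k
  refine Fin.lastCases ?_ (fun i => ?_) k <;> simp

theorem abs_le_of_form_of_neg {n : ℕ} {a : Fin n → ℝ} (ha : ∀ i, a i < 0)
    {v : Fin (n + 1) → ℝ} (k : Fin (n + 1)) :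
    |v k| ≤ √(-form a v v / Fin.snoc (α := fun _ => ℝ) (fun i => -a i) 1 k) := by
  refine Real.abs_le_sqrt ?_
  have hs : ∀ i, 0 ≤ -(a i * v i.castSucc * v i.castSucc) := fun i => by
    nlinarith [ha i, mul_self_nonneg (v i.castSucc)]
  have hform : -form a v v = ∑ i, -(a i * v i.castSucc * v i.castSucc) + v (Fin.last n) ^ 2 := by
    rw [form_apply, Finset.sum_neg_distrib]
    ring
  rw [hform]
  refine Fin.lastCases ?_ (fun i => ?_) k
  · rw [Fin.snoc_last, div_one]
    linarith [Finset.sum_nonneg fun i (_ : i ∈ Finset.univ) => hs i]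
  · rw [Fin.snoc_castSucc, le_div_iff₀ (neg_pos.2 (ha i))]
    have := Finset.single_le_sum (fun i _ => hs i) (Finset.mem_univ i)
    nlinarith [sq_nonneg (v (Fin.last n))]

/-- Integral vectors of given norm for a form that is definite at all real places but one form
a locally finite set at the remaining place. -/
theorem finite_setOf_form_eq {F : Type*} [Field F] [NumberField F] [IsTotallyReal F] {n : ℕ}
    (α : Fin n → 𝓞 F) (ι : F →+* ℝ) (hα : ∀ σ : F →+* ℝ, σ ≠ ι → ∀ i, σ (α i) < 0)
    (β : 𝓞 F) (R : ℝ) :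
    {v : Fin (n + 1) → 𝓞 F | form α v v = β ∧ ∀ k, |ι (v k)| ≤ R}.Finite := by
  have hreal : ∀ (σ : F →+* ℝ) (k : Fin (n + 1)), ∃ B, ∀ v : Fin (n + 1) → 𝓞 F,
      form α v v = β → (∀ k, |ι (v k)| ≤ R) → |σ (v k)| ≤ B := by
    intro σ k
    by_cases hσ : σ = ι
    · exact ⟨R, fun v _ hv => hσ ▸ hv k⟩
    -- At a place other than `ι` the form is negative definite, so its value `σ β` bounds every
    -- coordinate.
    · refine ⟨√(-σ β / Fin.snoc (α := fun _ => ℝ) (fun i => -σ (α i)) 1 k), fun v hv _ => ?_⟩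
      have h := abs_le_of_form_of_neg (hα σ hσ) (v := fun i => σ (v i)) k
      have hm := map_form (σ.comp (algebraMap (𝓞 F) F)) α v v
      rw [hv] at hm
      exact h.trans_eq (by rw [← RingHom.comp_apply, hm]; rfl)
  have hcomplex : ∀ (φ : F →+* ℂ) (k : Fin (n + 1)), ∃ B, ∀ v : Fin (n + 1) → 𝓞 F,
      form α v v = β → (∀ k, |ι (v k)| ≤ R) → ‖φ (v k)‖ ≤ B := by
    intro φ k
    have hφ := IsTotallyReal.complexEmbedding_isReal φ
    obtain ⟨B, hB⟩ := hreal hφ.embedding k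
    refine ⟨B, fun v hv hR => ?_⟩
    rw [← hφ.coe_embedding_apply, Complex.norm_real]
    exact hB v hv hR
  choose B hB using hcomplex
  obtain ⟨M, hM⟩ := Finite.exists_le fun p : (F →+* ℂ) × Fin (n + 1) => B p.1 p.2
  -- Only finitely many algebraic integers of `F` have all conjugates bounded by `M`.
  have hfin := (Embeddings.finite_of_norm_le F ℂ M).preimage
    (RingOfIntegers.coe_injective (K := F)).injOn
  refine (Set.Finite.pi' fun _ : Fin (n + 1) => hfin).subset fun v hv k => ?_
  exact ⟨(v k).isIntegral_coe, fun φ => (hB φ k v hv.1 hv.2).trans (hM (φ, k))⟩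

/-- The columns are integral vectors with the norms of the basis vectors, so `finite_setOf_form_eq`
applies. -/
theorem isDiscreteIsometryGroup_of_le {F : Type*} [Field F] [NumberField F] [IsTotallyReal F]
    {n : ℕ} (α : Fin n → 𝓞 F) (ι : F →+* ℝ)
    (hα : ∀ σ : F →+* ℝ, σ ≠ ι → ∀ i, σ (α i) < 0) {Γ : Subgroup (SLn (n + 1) ℝ)}
    (hΓ : Γ ≤ (specialOrthogonal α).map (toReal (n + 1) ι)) :
    IsDiscreteIsometryGroup (fun i => ι (α i)) Γ where
  form_eq γ hγ := by
    obtain ⟨A, hA, rfl⟩ := hΓ hγ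
    have h := congrArg (fun X => X.map (ι.comp (algebraMap (𝓞 F) F))) hA
    simp only [Matrix.map_mul, formMatrix_map] at h
    exact h
  finite_col i R := by
    refine ((finite_setOf_form_eq α ι hα (form α (Pi.single i 1) (Pi.single i 1)) R).image
      fun v k => ι (v k)).subset ?_
    rintro _ ⟨⟨γ, hγ, rfl⟩, hR⟩
    obtain ⟨A, hA, rfl⟩ := hΓ hγ
    refine ⟨(A : Matrix (Fin (n + 1)) (Fin (n + 1)) (𝓞 F)).col i, ⟨?_, hR⟩, rfl⟩
    rw [← Matrix.mulVec_single_one, form_mulVec hA]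

theorem map_specialOrthogonal_le {F L : Type*} [Field F] [NumberField F] [Field L] [NumberField L]
    [Algebra F L] (j : L →+* ℝ) (τ : L ≃ₐ[F] L) {n : ℕ} (α : Fin n → 𝓞 F) :
    (specialOrthogonal α).map (toReal (n + 1) (j.comp (algebraMap F L))) ≤
      (specialUnitary (fun i => algebraMap (𝓞 F) (𝓞 L) (α i))
        (RingOfIntegers.mapRingEquiv τ.toRingEquiv)).map (toReal (n + 1) j) := by
  rintro _ ⟨A, hA, rfl⟩
  refine ⟨Matrix.SpecialLinearGroup.map (algebraMap (𝓞 F) (𝓞 L)) A, ?_, ?_⟩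
  · have h := congrArg (fun X => X.map (algebraMap (𝓞 F) (𝓞 L))) hA
    simp only [Matrix.map_mul, formMatrix_map] at h
    have hτ : (((Matrix.SpecialLinearGroup.map (algebraMap (𝓞 F) (𝓞 L)) A : SLn (n + 1) (𝓞 L)) :
        Matrix (Fin (n + 1)) (Fin (n + 1)) (𝓞 L))ᵀ.map
          (RingOfIntegers.mapRingEquiv τ.toRingEquiv)) =
        (A : Matrix (Fin (n + 1)) (Fin (n + 1)) (𝓞 F))ᵀ.map (algebraMap (𝓞 F) (𝓞 L)) := by
      ext k l
      exact τ.commutes _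
    change _ * _ * _ = _
    rw [hτ]
    exact h
  · ext k l
    rfl

theorem bendingMatrix_mem {F L : Type*} [Field F] [NumberField F] [Field L] [NumberField L]
    [Algebra F L] (j : L →+* ℝ) (τ : L ≃ₐ[F] L) {n : ℕ} (α : Fin (n + 1) → 𝓞 L)
    (u : 𝓞 L) (hu : τ (u : L) * (u : L) = 1) :
    bendingMatrix (n + 1) (Real.log |j (u : L)|) ∈
      (specialUnitary α (RingOfIntegers.mapRingEquiv τ.toRingEquiv)).map (toReal (n + 2) j) := by
  -- Only `|j u|` enters, and `-u` is unitary as well.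
  wlog hpos : 0 < j (u : L) generalizing u
  · have hne : j (u : L) ≠ 0 := (map_ne_zero j).2 (right_ne_zero_of_mul_eq_one hu)
    have h := this (-u) (by simpa using hu)
      (by simpa using lt_of_le_of_ne (not_lt.1 hpos) hne)
    simpa using h
  set T := RingOfIntegers.mapRingEquiv τ.toRingEquiv with hT
  have hTu : T u * u = 1 := RingOfIntegers.ext hu
  have hjT : j (T u : L) = (j (u : L))⁻¹ := by
    refine eq_inv_of_mul_eq_one_left ?_
    have h := congrArg j hu
    rwa [map_mul, map_one] at h
  -- Since `j (T u)` is the inverse of `j u = e^t`, the power `T u ^ (n + 1)` is the integral form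
  -- of the entry `e^{-(n+1)t}`.
  let d : Fin (n + 2) → 𝓞 L := Fin.cons (T u ^ (n + 1)) fun _ => u
  have hd : (Matrix.diagonal d).det = 1 := by
    rw [Matrix.det_diagonal, Fin.prod_univ_succ]
    simp only [d, Fin.cons_zero, Fin.cons_succ, Finset.prod_const, Finset.card_univ,
      Fintype.card_fin]
    rw [← mul_pow, hTu, one_pow]
  have hdT : ∀ k, T (d k) * d k = 1 := by
    have hTT : T (T u) * T u = 1 := by rw [← map_mul, hTu, map_one]
    intro k
    refine Fin.cases ?_ (fun i => hTu) k
    simp only [d, Fin.cons_zero]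
    rw [map_pow, ← mul_pow, hTT, one_pow]
  refine ⟨⟨Matrix.diagonal d, hd⟩, ?_, ?_⟩
  · change (Matrix.diagonal d)ᵀ.map T * Matrix.diagonal _ * Matrix.diagonal d = Matrix.diagonal _
    rw [Matrix.diagonal_transpose, Matrix.diagonal_map (map_zero T), Matrix.diagonal_mul_diagonal,
      Matrix.diagonal_mul_diagonal]
    congr 1
    ext1 k
    rw [mul_right_comm, hdT, one_mul]
  · apply Subtype.ext
    change (Matrix.diagonal d).map (j.comp (algebraMap (𝓞 L) L)) = Matrix.diagonal _
    rw [Matrix.diagonal_map (map_zero _), abs_of_pos hpos]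
    congr 1
    ext1 k
    refine Fin.cases ?_ (fun i => ?_) k
    · simp only [Fin.cons_zero, d, RingHom.comp_apply, map_pow]
      rw [hjT, Real.exp_neg, Real.exp_nat_mul, Real.exp_log hpos, inv_pow]
    · simp only [Fin.cons_succ, d, RingHom.comp_apply]
      rw [Real.exp_log hpos]

/-- The bending matrix is scalar on each of the two diagonal blocks. -/
theorem commute_bendingMatrix_block {n : ℕ} (t : ℝ) (δ : SLn n ℝ) :
    Commute (bendingMatrix n t) (block δ) := by
  apply Subtype.ext
  change Matrix.diagonal _ * blockMatrix _ = blockMatrix _ * Matrix.diagonal _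
  ext k l
  rw [Matrix.diagonal_mul, Matrix.mul_diagonal]
  refine Fin.cases ?_ (fun i => ?_) k <;> refine Fin.cases ?_ (fun i' => ?_) l <;>
    simp [blockMatrix, mul_comm]

end Bending

/-! ### Unitarity of the bent group -/

theorem mainTheorem8
    {F L : Type*} [Field F] [NumberField F] [NumberField.IsTotallyReal F]
    [Field L] [NumberField L] [Algebra F L] (hL : Module.finrank F L = 2)
    (j : L →+* ℝ) (τ : L ≃ₐ[F] L) (hτ : τ ≠ AlgEquiv.refl)
    {m : ℕ} (α : Fin (m + 1) → NumberField.RingOfIntegers F)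
    (hα_pos : ∀ i, 0 < j (algebraMap F L (α i)))
    (hα_neg : ∀ σ : F →+* ℝ, σ ≠ j.comp (algebraMap F L) → ∀ i, σ (α i) < 0)
    (Γ : Subgroup (Bending.SLn (m + 2) ℝ)) (Γ₁ : Subgroup (Bending.SLn (m + 1) ℝ))
    (hΓ : Γ ≤ (Bending.specialOrthogonal α).map
      (Bending.toReal (m + 2) (j.comp (algebraMap F L))))
    (hΓ_fin : Γ.IsFiniteRelIndex ((Bending.specialOrthogonal α).map
      (Bending.toReal (m + 2) (j.comp (algebraMap F L)))))
    (hΓ₁ : Γ₁ ≤ (Bending.specialOrthogonal (Fin.tail α)).map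
      (Bending.toReal (m + 1) (j.comp (algebraMap F L))))
    (hΓ₁_fin : Γ₁.IsFiniteRelIndex ((Bending.specialOrthogonal (Fin.tail α)).map
      (Bending.toReal (m + 1) (j.comp (algebraMap F L)))))
    (hM : Bending.IsManifoldGroup (fun i => j (algebraMap F L (α i))) Γ)
    (hM₁ : Bending.IsEmbeddedHypersurface (fun i => j (algebraMap F L (α i))) Γ Γ₁)
    (u : NumberField.RingOfIntegers L) (hu : τ (u : L) * (u : L) = 1)
    (t : ℝ) (ht : t = Real.log |j (u : L)|) :
    Bending.bendingMatrix (m + 1) t ∈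
      (Bending.specialUnitary (fun i => algebraMap (NumberField.RingOfIntegers F)
          (NumberField.RingOfIntegers L) (α i))
        (NumberField.RingOfIntegers.mapRingEquiv τ.toRingEquiv)).map (Bending.toReal (m + 2) j) ∧
    (∀ δ ∈ Γ₁, Commute (Bending.bendingMatrix (m + 1) t) (Bending.block δ)) ∧
    ∀ ρ : Γ →* Bending.SLn (m + 2) ℝ,
      Bending.IsBending (fun i => j (algebraMap F L (α i))) Γ t ρ →
      ρ.range ≤ (Bending.specialUnitary (fun i => algebraMap (NumberField.RingOfIntegers F)
          (NumberField.RingOfIntegers L) (α i))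
        (NumberField.RingOfIntegers.mapRingEquiv τ.toRingEquiv)).map (Bending.toReal (m + 2) j) := by
  have hB := Bending.bendingMatrix_mem j τ (fun i => algebraMap (NumberField.RingOfIntegers F)
    (NumberField.RingOfIntegers L) (α i)) u hu
  rw [← ht] at hB
  have hSO := hΓ.trans (Bending.map_specialOrthogonal_le j τ α)
  refine ⟨hB, fun δ _ => Bending.commute_bendingMatrix_block t δ, ?_⟩
  rintro ρ ⟨C₁, C₂, hC, h₁, hsep, hnonsep⟩
  have hD := Bending.isDiscreteIsometryGroup_of_le α _ hα_neg hΓ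
  -- The claim becomes that the preimage of the unitary group is all of `Γ`, the form in which the
  -- generation results apply.
  rw [MonoidHom.range_eq_map, Subgroup.map_le_iff_le_comap, top_le_iff]
  have hstab : ∀ γ : Γ, Bending.translate (γ : Bending.SLn (m + 2) ℝ) C₁ = C₁ →
      γ ∈ Subgroup.comap ρ ((Bending.specialUnitary (fun i =>
        algebraMap (NumberField.RingOfIntegers F) (NumberField.RingOfIntegers L) (α i))
        (NumberField.RingOfIntegers.mapRingEquiv τ.toRingEquiv)).map
          (Bending.toReal (m + 2) j)) := by
    intro γ hγ
    rw [Subgroup.mem_comap, h₁ γ hγ]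
    exact hSO γ.2
  by_cases h : Bending.IsSeparating (fun i => j (algebraMap F L (α i))) Γ
  · refine hC.eq_top_of_isSeparating hα_pos hD hM hM₁ h _ hstab fun γ hγ => ?_
    rw [Subgroup.mem_comap, hsep h γ hγ]
    exact mul_mem (mul_mem hB (hSO γ.2)) (inv_mem hB)
  · obtain ⟨s, hs, hρs⟩ := hnonsep h
    refine hC.eq_top_of_translate_eq hα_pos hD hM hM₁ _ hstab (s := s) ?_ hs
    rw [Subgroup.mem_comap, hρs]
    exact mul_mem hB (hSO s.2)
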